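/- Let $p\ge 1$ and $d$ be integers, let $A\in M_d(\mathbb C)$ have minimal polynomial $M_A(z)=(z-\lambda)^m$, where $\lambda\neq 0$ if $m\ge 2$, and let $j\in\{0,1,\dots,p-1\}$. Put $$f_j(z)=|z|^{1/p}\exp\big(i(\arg z+2\pi j)/p\big),\qquad -\pi<\arg z\le\pi .$$ Write $M_A(z)=z^m-a_0z^{m-1}-\cdots-a_{m-1}$ and let $A_0=I_d$, $A_{s+1}=A\,A_s-a_sI_d$ be the associated Fibonacci–Hörner system. Let $D=t\frac{d}{dt}$, let $S_{h,i}$ be the signed Stirling numbers of the first kind, given by $x(x-1)\cdots(x-h+1)=\sum_i S_{h,i}x^i$, let $$C_i=\sum_{h=i}^{m-1}\binom{m-1}{h}\frac{S_{h,i}}{h!}\qquad(1\le i\le m-1),$$ and define, with the principal power $(1-\lambda t)^{1/p}$, $$\varphi_0(t)=(1-\lambda t)^{1/p}+\sum_{i=1}^{m-1}C_iD^i(1-\lambda t)^{1/p},$$ $$\varphi_s(t)=\frac1{\lambda^s}(1-\lambda t)^{1/p}+\sum_{i=1}^{m-1}\sum_{k=0}^{i}\frac{C_i}{\lambda^s}(-s)^{i-k}\binom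 ik D^k(1-\lambda t)^{1/p}\qquad(1\le s\le m-1).$$ Then, for every non-zero parameter $t$ (real or complex, the derivatives in $D$ being taken with respect to the real or complex variable $t$ accordingly) with $|t\lambda|<1$, the function $f_j$ is defined on the spectrum of $I_d-tA$ (it is holomorphic near every multiple root of the minimal polynomial), and the primary matrix function $f_j(I_d-tA)$, that is, the value at $I_d-tA$ of any Hermite interpolation polynomial of $f_j$ on the roots, with multiplicity, of the minimal polynomial of $I_d-tA$, satisfies $$f_j(I_d-tA)=\exp(2i\pi j/p)\sum_{s=0}^{m-1}\varphi_s(t)\,A_s .$$ -/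

import Mathlib

open Polynomial

noncomputable section

namespace PrimaryRoot

/-- The `j`-th branch of the `p`-th root, `f_j(z) = |z|^{1/p} exp(i (arg z + 2 π j) / p)`, with the
principal argument `-π < arg z ≤ π`. -/
def rootBranch (p j : ℕ) (z : ℂ) : ℂ :=
  ((‖z‖ ^ (1 / (p : ℝ)) : ℝ) : ℂ) *
    Complex.exp (Complex.I * ((z.arg : ℂ) + 2 * (Real.pi : ℂ) * (j : ℂ)) / (p : ℂ))

/-! ### Primary matrix functions -/

/-- `q` is a Hermite interpolation polynomial of the scalar function `f` on the roots of `M`: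
`q^{(k)}(μ) = f^{(k)}(μ)` for every root `μ` of `M` and every `k` below its multiplicity. -/
def IsHermiteInterpolant (f : ℂ → ℂ) (M q : ℂ[X]) : Prop :=
  ∀ (μ : ℂ) (k : ℕ), k < M.rootMultiplicity μ →
    (derivative^[k] q).eval μ = iteratedDeriv k f μ

theorem exists_hermiteInterpolant (f : ℂ → ℂ) (M : ℂ[X]) :
    ∃ q : ℂ[X], IsHermiteInterpolant f M q := by
  suffices h : ∀ s : Multiset ℂ, ∃ q : ℂ[X], ∀ (μ : ℂ) (k : ℕ), k < s.count μ →
      (derivative^[k] q).eval μ = iteratedDeriv k f μ by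
    obtain ⟨q, hq⟩ := h M.roots
    exact ⟨q, fun μ k hk => hq μ k (by rwa [count_roots])⟩
  intro s
  induction s using Multiset.induction_on with
  | empty => exact ⟨0, by simp⟩
  | cons a s ih =>
    obtain ⟨q, hq⟩ := ih
    set N : ℂ[X] := (s.map fun x => X - C x).prod with hN
    have hN0 : N ≠ 0 := (monic_multiset_prod_of_monic s _ fun x _ => monic_X_sub_C x).ne_zero
    have hcount : ∀ μ, N.rootMultiplicity μ = s.count μ := by
      intro μ
      rw [← count_roots, hN, roots_multiset_prod_X_sub_C]
    have hne : (derivative^[s.count a] N).eval a ≠ 0 := by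
      intro h0
      have h1 : s.count a < N.rootMultiplicity a := by
        rw [lt_rootMultiplicity_iff_isRoot_iterate_derivative hN0]
        intro k hk
        rcases hk.lt_or_eq with hk | rfl
        · exact isRoot_iterate_derivative_of_lt_rootMultiplicity (by rwa [hcount])
        · exact h0
      rw [hcount] at h1
      exact lt_irrefl _ h1
    refine ⟨q + C ((iteratedDeriv (s.count a) f a - (derivative^[s.count a] q).eval a) /
      (derivative^[s.count a] N).eval a) * N, fun μ k hk => ?_⟩
    rw [iterate_map_add, iterate_derivative_C_mul, eval_add, eval_C_mul]
    by_cases hlt : k < s.count μ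
    · have h2 : (derivative^[k] N).eval μ = 0 :=
        isRoot_iterate_derivative_of_lt_rootMultiplicity (by rwa [hcount])
      rw [h2, mul_zero, add_zero, hq μ k hlt]
    · rw [Multiset.count_cons] at hk
      split_ifs at hk with h3
      · subst h3
        have h4 : k = s.count μ := by omega
        subst h4
        rw [div_mul_cancel₀ _ hne]
        ring
      · omega

/-- `f` is defined on the spectrum of `B`: it is holomorphic near every eigenvalue that is a
multiple root of the minimal polynomial, so that the derivatives of `f` which enter the
interpolation conditions exist (at a simple root only the value of `f` enters). -/
def DefinedOnSpectrum {d : ℕ} (f : ℂ → ℂ) (B : Matrix (Fin d) (Fin d) ℂ) : Prop :=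
  ∀ μ : ℂ, 1 < (minpoly ℂ B).rootMultiplicity μ → AnalyticAt ℂ f μ

/-- The primary matrix function `f(B)`: the value at `B` of a Hermite interpolation polynomial of
`f` on the roots of the minimal polynomial of `B`. -/
def primaryMatrixFunction {d : ℕ} (f : ℂ → ℂ) (B : Matrix (Fin d) (Fin d) ℂ) :
    Matrix (Fin d) (Fin d) ℂ :=
  aeval B (exists_hermiteInterpolant f (minpoly ℂ B)).choose

/-- The value of a primary matrix function does not depend on the interpolation polynomial. -/
theorem primaryMatrixFunction_eq_aeval {d : ℕ} {f : ℂ → ℂ} {B : Matrix (Fin d) (Fin d) ℂ}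
    {q : ℂ[X]} (hq : IsHermiteInterpolant f (minpoly ℂ B) q) :
    primaryMatrixFunction f B = aeval B q := by
  have hc := (exists_hermiteInterpolant f (minpoly ℂ B)).choose_spec
  rw [primaryMatrixFunction]
  set c := (exists_hermiteInterpolant f (minpoly ℂ B)).choose
  rw [← sub_eq_zero, ← map_sub]
  by_cases h0 : c - q = 0
  · rw [h0, map_zero]
  · have hdvd : minpoly ℂ B ∣ c - q := by
      have hM : minpoly ℂ B ≠ 0 := minpoly.ne_zero (Matrix.isIntegral B)
      refine (IsAlgClosed.splits (minpoly ℂ B)).dvd_of_roots_le_roots hM ?_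
      rw [Multiset.le_iff_count]
      intro μ
      rw [count_roots, count_roots]
      by_contra! hlt
      refine lt_irrefl ((c - q).rootMultiplicity μ) ?_
      rw [lt_rootMultiplicity_iff_isRoot_iterate_derivative h0]
      intro k hk
      rw [IsRoot, iterate_derivative_sub, eval_sub, hc μ k (hk.trans_lt hlt),
        hq μ k (hk.trans_lt hlt), sub_self]
    obtain ⟨r, hr⟩ := hdvd
    rw [hr, map_mul, minpoly.aeval, zero_mul]

/-! ### The Fibonacci–Hörner system -/

/-- The Hörner polynomials of a monic polynomial `P(z) = z^r - a_0 z^{r-1} - ⋯ - a_{r-1}`: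
`P_0 = 1` and `P_{j+1}(z) = z P_j(z) - a_j`, where `a_j` is minus the coefficient of
`z^{r-1-j}` in `P`. They are used for indices at most `r` only. -/
def hornerPoly (P : ℂ[X]) : ℕ → ℂ[X]
  | 0 => 1
  | j + 1 => X * hornerPoly P j - C (-P.coeff (P.natDegree - 1 - j))

/-- The matrices `A_s = P_s(A)` of the Hörner system of `A` attached to its minimal polynomial. -/
def hornerMatrix {d : ℕ} (A : Matrix (Fin d) (Fin d) ℂ) (s : ℕ) : Matrix (Fin d) (Fin d) ℂ :=
  aeval A (hornerPoly (minpoly ℂ A) s)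

/-! ### The coefficient functions -/

/-- Signed Stirling numbers of the first kind:
`x (x - 1) ⋯ (x - h + 1) = ∑ i, S_{h,i} x ^ i`. -/
def signedStirling (h i : ℕ) : ℤ := (-1) ^ (h + i) * (Nat.stirlingFirst h i : ℤ)

/-- `C_i = ∑_{h=i}^{m-1} binom(m-1, h) S_{h,i} / h!`. -/
def binetCoeff (m i : ℕ) : ℂ :=
  ∑ h ∈ Finset.Icc i (m - 1),
    ((m - 1).choose h : ℂ) * (signedStirling h i : ℂ) / (h.factorial : ℂ)

/-- The operator `D = t d/dt` on complex-valued functions of a variable `t` in `𝕜`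
(with `𝕜 = ℝ` or `𝕜 = ℂ` in mind). -/
def degreeOp {𝕜 : Type*} [RCLike 𝕜] [NormedAlgebra 𝕜 ℂ] (g : 𝕜 → ℂ) : 𝕜 → ℂ :=
  fun t => t • deriv g t

/-- The function `t ↦ (1 - λ t)^{1/p}` (principal power). -/
def rootFun {𝕜 : Type*} [RCLike 𝕜] [NormedAlgebra 𝕜 ℂ] (p : ℕ) (lam : ℂ) : 𝕜 → ℂ :=
  fun t => (1 - t • lam) ^ (1 / (p : ℂ))

/-- The functions `φ_s(t)`:
`φ_0(t) = (1 - λ t)^{1/p} + ∑_{i=1}^{m-1} C_i D^i (1 - λ t)^{1/p}` and, for `s ≥ 1`,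
`φ_s(t) = λ^{-s} (1 - λ t)^{1/p}
  + ∑_{i=1}^{m-1} ∑_{k=0}^{i} C_i λ^{-s} (-s)^{i-k} binom(i, k) D^k (1 - λ t)^{1/p}`. -/
def phi {𝕜 : Type*} [RCLike 𝕜] [NormedAlgebra 𝕜 ℂ] (p m : ℕ) (lam : ℂ) : ℕ → 𝕜 → ℂ
  | 0, t => rootFun p lam t
      + ∑ i ∈ Finset.Icc 1 (m - 1), binetCoeff m i * degreeOp^[i] (rootFun p lam) t
  | s + 1, t => 1 / lam ^ (s + 1) * rootFun p lam t
      + ∑ i ∈ Finset.Icc 1 (m - 1), ∑ k ∈ Finset.range (i + 1),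
          binetCoeff m i / lam ^ (s + 1) * (-((s + 1 : ℕ) : ℂ)) ^ (i - k) * (i.choose k : ℂ)
            * degreeOp^[k] (rootFun p lam) t

end PrimaryRoot

end

noncomputable section
namespace PrimaryRoot

/-! ### The Hörner system and the powers of `A` -/

/-! Let P(x) = binom(x + m - 1, m - 1), expanded as ∑ C_i x^i. It has degree below m, P(0) = 1 and
P(-1) = ... = P(-(m-1)) = 0, while λ^n P(n) obeys the recurrence with characteristic polynomial (z -
λ)^m. Hence A^n = ∑_s λ^(n-s) P(n - s) A_s (`pow_eq_sum_smul_hornerMatrix`).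

Since D multiplies t^n by n, summing over monomials gives r(tA) = ∑_s λ^(-s) [P(D - s) r(λt)] A_s
for every polynomial r (`aeval_smul_eq_sum_phiFunctional`). The bracket, with its factor λ^(-s), is
φ_s with r(λt) in place of (1 - λt)^(1/p).

Only D^k with k < m occurs, so only the jet of order m - 1 at t matters (`iterate_degreeOp_jet`).
Take r(z) = q(1 - z), where q interpolates the principal root to order m at 1 - tλ: then r(λt) has
the right jet, and r(tA) = q(1 - tA). Near 1 - tλ the branch f_j is the principal root times a
constant. -/

theorem coeff_hornerPoly {P : ℂ[X]} (hP : P.Monic) {j : ℕ} (hj : j ≤ P.natDegree) (k : ℕ) :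
    (hornerPoly P j).coeff k = P.coeff (k + (P.natDegree - j)) := by
  induction j generalizing k with
  | zero =>
    rw [hornerPoly, coeff_one, Nat.sub_zero]
    split_ifs with h
    · rw [h, zero_add, hP.coeff_natDegree]
    · rw [coeff_eq_zero_of_natDegree_lt (by omega)]
  | succ j ih =>
    rw [hornerPoly, coeff_sub, coeff_C]
    rcases k with _ | k
    · rw [coeff_X_mul_zero, if_pos rfl, zero_sub, neg_neg]
      congr 1
      omega
    · rw [coeff_X_mul, ih (by omega), if_neg (Nat.succ_ne_zero k), sub_zero]
      congr 1
      omega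

theorem hornerPoly_natDegree {P : ℂ[X]} (hP : P.Monic) : hornerPoly P P.natDegree = P := by
  ext k
  rw [coeff_hornerPoly hP le_rfl, Nat.sub_self, add_zero]

section Horner

variable {d : ℕ} {A : Matrix (Fin d) (Fin d) ℂ} {m : ℕ} {lam : ℂ}

theorem hornerMatrix_zero : hornerMatrix A 0 = 1 := by
  rw [hornerMatrix, hornerPoly, map_one]

/-- The binomial expansion of (z - λ)^m gives a_s = (-1)^s λ^(s+1) binom(m, s+1). -/
theorem mul_hornerMatrix (hA : minpoly ℂ A = (X - C lam) ^ m) {s : ℕ} (hs : s < m) :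
    A * hornerMatrix A s = hornerMatrix A (s + 1) +
      ((-1) ^ s * lam ^ (s + 1) * (m.choose (s + 1) : ℂ)) • hornerMatrix A 0 := by
  have hc : -(minpoly ℂ A).coeff ((minpoly ℂ A).natDegree - 1 - s) =
      (-1) ^ s * lam ^ (s + 1) * (m.choose (s + 1) : ℂ) := by
    rw [hA, natDegree_pow, natDegree_X_sub_C, mul_one, sub_eq_add_neg, ← C_neg, coeff_X_add_C_pow,
      show m - (m - 1 - s) = s + 1 by omega,
      show m - 1 - s = m - (s + 1) by omega, Nat.choose_symm (by omega), neg_pow]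
    ring
  rw [hornerMatrix_zero, hornerMatrix, hornerMatrix, hornerPoly, map_sub, map_mul, aeval_X,
    aeval_C, hc, Algebra.algebraMap_eq_smul_one, sub_add_cancel]

theorem hornerMatrix_eq_zero (hA : minpoly ℂ A = (X - C lam) ^ m) : hornerMatrix A m = 0 := by
  have hdeg : (minpoly ℂ A).natDegree = m := by
    rw [hA, natDegree_pow, natDegree_X_sub_C, mul_one]
  have h := hornerPoly_natDegree (minpoly.monic (Matrix.isIntegral A))
  rw [hdeg] at h
  rw [hornerMatrix, h, minpoly.aeval]

end Horner

/-- A polynomial of degree less than `m` satisfies the recurrence with characteristic polynomial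
`(z - 1) ^ m`. -/
theorem eval_add_one_eq_sum {P : ℂ[X]} {m : ℕ} (hP : P.natDegree < m) (x : ℂ) :
    P.eval (x + 1) =
      ∑ s ∈ Finset.range m, (-1) ^ s * (m.choose (s + 1) : ℂ) * P.eval (x - s) := by
  -- The reflection Q(k) = P(x + 1 - k) turns the recurrence into the vanishing of the m-th forward
  -- difference of Q at 0.
  set Q : ℂ[X] := P.comp (C (x + 1) - X) with hQ
  have hdeg : Q.natDegree < m := by
    refine lt_of_le_of_lt (natDegree_comp_le) ?_
    have h1 : (C (x + 1) - X : ℂ[X]).natDegree ≤ 1 := by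
      refine (natDegree_sub_le _ _).trans ?_
      simp
    calc _ ≤ P.natDegree * 1 := Nat.mul_le_mul_left _ h1
      _ < m := by rwa [mul_one]
  have h := congrFun (Polynomial.fwdDiff_iter_eq_zero_of_degree_lt hdeg) 0
  rw [fwdDiff_iter_eq_sum_shift, Pi.zero_apply] at h
  have h2 : ∑ k ∈ Finset.range (m + 1), (-1) ^ k * (m.choose k : ℂ) * P.eval (x + 1 - k) = 0 := by
    have h3 := congrArg (fun z => (-1 : ℂ) ^ m * z) h
    simp only [mul_zero, Finset.mul_sum] at h3
    rw [← h3]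
    refine Finset.sum_congr rfl fun k hk => ?_
    have hk' : k ≤ m := Nat.lt_succ_iff.mp (Finset.mem_range.mp hk)
    have hsign : (-1 : ℂ) ^ m * (-1) ^ (m - k) = (-1) ^ k := by
      obtain ⟨l, rfl⟩ := Nat.exists_eq_add_of_le hk'
      rw [Nat.add_sub_cancel_left, pow_add, mul_assoc, ← mul_pow, neg_one_mul, neg_neg, one_pow,
        mul_one]
    rw [hQ, eval_comp, zsmul_eq_mul]
    push_cast
    simp only [zero_add, nsmul_eq_mul, mul_one, eval_sub, eval_C, eval_X]
    rw [← hsign]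
    ring
  rw [Finset.sum_range_succ'] at h2
  simp only [pow_zero, Nat.choose_zero_right, Nat.cast_zero, Nat.cast_one, one_mul,
    sub_zero] at h2
  rw [eq_comm, ← sub_eq_zero, ← neg_eq_zero, ← h2, neg_sub, sub_eq_add_neg, add_comm,
    ← Finset.sum_neg_distrib]
  congr 1
  refine Finset.sum_congr rfl fun s _ => ?_
  push_cast
  ring_nf

/-- Multiplication by A moves the coefficient of A_s to A_(s+1) and feeds A_0 by the recurrence for
P. The values of P at 0, -1, ..., -(m-1) are the initial data. The form of `hlam` admits λ = 0 when
m = 1. -/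
theorem pow_eq_sum_smul_hornerMatrix {d : ℕ} {A : Matrix (Fin d) (Fin d) ℂ} {m : ℕ} {lam : ℂ}
    (hA : minpoly ℂ A = (X - C lam) ^ m) (hlam : ∀ s < m, lam ^ s ≠ 0) {P : ℂ[X]}
    (hdeg : P.natDegree < m) (h0 : P.eval 0 = 1)
    (hneg : ∀ s : ℕ, 1 ≤ s → s < m → P.eval (-(s : ℂ)) = 0) (n : ℕ) :
    A ^ n = ∑ s ∈ Finset.range m,
      (lam ^ n / lam ^ s * P.eval ((n : ℂ) - s)) • hornerMatrix A s := by
  induction n with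
  | zero =>
    rw [Finset.sum_eq_single_of_mem 0 (Finset.mem_range.mpr (by omega))]
    · simp [h0, hornerMatrix_zero]
    · intro s hs hs0
      rw [Nat.cast_zero, zero_sub, hneg s (by omega) (Finset.mem_range.mp hs), mul_zero, zero_smul]
  | succ n ih =>
    obtain ⟨r, rfl⟩ : ∃ r, m = r + 1 := ⟨m - 1, by omega⟩
    have hstep : A ^ (n + 1) = ∑ s ∈ Finset.range (r + 1),
        ((lam ^ n / lam ^ s * P.eval ((n : ℂ) - s)) • hornerMatrix A (s + 1) +
        (lam ^ (n + 1) * ((-1) ^ s * ((r + 1).choose (s + 1) : ℂ) * P.eval ((n : ℂ) - s))) •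
          hornerMatrix A 0) := by
      rw [pow_succ', ih, Finset.mul_sum]
      refine Finset.sum_congr rfl fun s hs => ?_
      have hs' := Finset.mem_range.mp hs
      rw [mul_smul_comm, mul_hornerMatrix hA hs', smul_add, smul_smul]
      congr 2
      have := hlam s hs'
      field_simp
      ring
    rw [hstep, Finset.sum_add_distrib, ← Finset.sum_smul, ← Finset.mul_sum,
      ← eval_add_one_eq_sum hdeg, Finset.sum_range_succ, hornerMatrix_eq_zero hA, smul_zero,
      add_zero, Finset.sum_range_succ']
    congr 1
    · refine Finset.sum_congr rfl fun s hs => ?_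
      have hne := hlam (s + 1) (by have := Finset.mem_range.mp hs; omega)
      have hl : lam ≠ 0 := fun h => hne (by rw [h, zero_pow (Nat.succ_ne_zero s)])
      congr 1
      push_cast
      rw [add_sub_add_right_eq_sub]
      field_simp
      ring
    · simp

/-! ### The Binet coefficients -/

theorem signedStirling_eq_zero_of_lt {h i : ℕ} (hi : h < i) : signedStirling h i = 0 := by
  rw [signedStirling, Nat.stirlingFirst_eq_zero_of_lt hi, Nat.cast_zero, mul_zero]

theorem coeff_descPochhammer (h i : ℕ) :
    (descPochhammer ℤ h).coeff i = signedStirling h i := by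
  induction h generalizing i with
  | zero =>
    rw [descPochhammer_zero, coeff_one, signedStirling]
    rcases i with _ | i <;> simp
  | succ h ih =>
    rw [descPochhammer_succ_right, mul_sub, coeff_sub, ← C_eq_natCast, coeff_mul_C]
    rcases i with _ | i
    · rw [coeff_mul_X_zero, ih]
      rcases h with _ | h <;> simp [signedStirling]
    · rw [coeff_mul_X, ih, ih]
      simp only [signedStirling, Nat.stirlingFirst_succ_succ]
      push_cast
      ring

/-- The polynomial `∑ C_i x ^ i`; at a natural number `n` its value is
`binom (n + m - 1) (m - 1)`. -/
def binetPoly (m : ℕ) : ℂ[X] := ∑ i ∈ Finset.range m, C (binetCoeff m i) * X ^ i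

theorem binetCoeff_zero (m : ℕ) : binetCoeff m 0 = 1 := by
  rw [binetCoeff, Finset.sum_eq_single_of_mem 0 (by simp)]
  · simp [signedStirling]
  · intro h _ hh
    obtain ⟨l, rfl⟩ := Nat.exists_eq_succ_of_ne_zero hh
    simp [signedStirling]

theorem natDegree_binetPoly_lt {m : ℕ} (hm : 1 ≤ m) : (binetPoly m).natDegree < m := by
  refine lt_of_le_of_lt (natDegree_sum_le_of_forall_le _ _ (n := m - 1) fun i hi => ?_)
    (by omega)
  exact (natDegree_C_mul_X_pow_le _ _).trans (by have := Finset.mem_range.mp hi; omega)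

theorem eval_binetPoly (m : ℕ) (x : ℂ) :
    (binetPoly m).eval x = ∑ i ∈ Finset.range m, binetCoeff m i * x ^ i := by
  simp [binetPoly, eval_finsetSum]

theorem eval_descPochhammer_intCast (h : ℕ) (x : ℤ) :
    ∑ i ∈ Finset.range (h + 1), (signedStirling h i : ℂ) * (x : ℂ) ^ i =
      (h.factorial : ℂ) * ((Ring.choose x h : ℤ) : ℂ) := by
  have h1 : (descPochhammer ℤ h).eval x = (h.factorial : ℤ) * Ring.choose x h := by
    have := Ring.descPochhammer_eq_factorial_smul_choose x h
    rw [nsmul_eq_mul] at this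
    rw [← this, Polynomial.eval_eq_smeval]
  have h2 : (descPochhammer ℤ h).eval x =
      ∑ i ∈ Finset.range (h + 1), signedStirling h i * x ^ i := by
    rw [eval_eq_sum_range' (n := h + 1)]
    · simp only [coeff_descPochhammer]
    · rw [descPochhammer_natDegree]
      exact Nat.lt_succ_self h
  have h3 := congrArg (Int.cast : ℤ → ℂ) (h2.symm.trans h1)
  push_cast at h3
  exact h3

/-- Chu–Vandermonde: expand binom(x + m - 1, m - 1) in the binom(x, h), then each h! binom(x, h) in
powers of x. Integer x is needed to reach the zeros at negative arguments. -/
theorem eval_binetPoly_intCast {m : ℕ} (hm : 1 ≤ m) (x : ℤ) :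
    (binetPoly m).eval (x : ℂ) = (Ring.choose (x + ((m - 1 : ℕ) : ℤ)) (m - 1) : ℤ) := by
  obtain ⟨r, rfl⟩ : ∃ r, m = r + 1 := ⟨m - 1, by omega⟩
  rw [Nat.add_sub_cancel, Ring.add_choose_eq r (Commute.all _ _),
    Finset.Nat.sum_antidiagonal_eq_sum_range_succ_mk]
  push_cast
  have hterm : ∀ h ∈ Finset.range (r + 1),
      ((Ring.choose x h : ℤ) : ℂ) * ((Ring.choose ((r : ℕ) : ℤ) (r - h) : ℤ) : ℂ) =
        ∑ i ∈ Finset.range (r + 1),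
          (r.choose h : ℂ) * (signedStirling h i : ℂ) / (h.factorial : ℂ) * (x : ℂ) ^ i := by
    intro h hh
    have hh' : h ≤ r := Nat.lt_succ_iff.mp (Finset.mem_range.mp hh)
    have hext : ∑ i ∈ Finset.range (r + 1), (signedStirling h i : ℂ) * (x : ℂ) ^ i =
        ∑ i ∈ Finset.range (h + 1), (signedStirling h i : ℂ) * (x : ℂ) ^ i := by
      refine (Finset.sum_subset (Finset.range_mono (by omega)) fun i _ hi => ?_).symm
      rw [signedStirling_eq_zero_of_lt (by simpa using hi), Int.cast_zero, zero_mul]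
    have hfac : (h.factorial : ℂ) ≠ 0 := Nat.cast_ne_zero.mpr h.factorial_ne_zero
    have hpull : ∑ i ∈ Finset.range (r + 1),
          (r.choose h : ℂ) * (signedStirling h i : ℂ) / (h.factorial : ℂ) * (x : ℂ) ^ i =
        (r.choose h : ℂ) / (h.factorial : ℂ) *
          ∑ i ∈ Finset.range (r + 1), (signedStirling h i : ℂ) * (x : ℂ) ^ i := by
      rw [Finset.mul_sum]
      exact Finset.sum_congr rfl fun i _ => by ring
    rw [hpull, hext, eval_descPochhammer_intCast, Ring.choose_natCast, Nat.choose_symm hh']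
    push_cast
    field_simp
  rw [Finset.sum_congr rfl hterm, Finset.sum_comm, eval_binetPoly]
  refine Finset.sum_congr rfl fun i _ => ?_
  rw [binetCoeff, Nat.add_sub_cancel, Finset.sum_mul]
  refine Finset.sum_subset (fun h hh => ?_) fun h hh hi => ?_
  · have := Finset.mem_Icc.mp hh
    exact Finset.mem_range.mpr (by omega)
  · have h1 := Finset.mem_range.mp hh
    have h2 : h < i := by
      by_contra hlt
      exact hi (Finset.mem_Icc.mpr (by omega))
    rw [signedStirling_eq_zero_of_lt h2]
    simp

theorem eval_zero_binetPoly {m : ℕ} (hm : 1 ≤ m) : (binetPoly m).eval 0 = 1 := by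
  have h := eval_binetPoly_intCast hm 0
  rwa [zero_add, Ring.choose_natCast, Nat.choose_self, Int.cast_zero, Nat.cast_one,
    Int.cast_one] at h

theorem eval_neg_binetPoly {m s : ℕ} (hs : 1 ≤ s) (hsm : s < m) :
    (binetPoly m).eval (-(s : ℂ)) = 0 := by
  have h := eval_binetPoly_intCast (by omega : 1 ≤ m) (-(s : ℤ))
  rw [show -(s : ℤ) + ((m - 1 : ℕ) : ℤ) = ((m - 1 - s : ℕ) : ℤ) by omega, Ring.choose_natCast,
    Nat.choose_eq_zero_of_lt (by omega)] at h
  simpa using h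

open Filter Topology

/-! ### The coefficient functions as functionals of the iterates of `D` -/

/-- The expression defining `phi` with `D ^ k (1 - λ t) ^ {1/p}` replaced by `v k`. -/
def phiFunctional (m : ℕ) (lam : ℂ) (s : ℕ) (v : ℕ → ℂ) : ℂ :=
  1 / lam ^ s * ∑ i ∈ Finset.range m, ∑ k ∈ Finset.range (i + 1),
    binetCoeff m i * (-(s : ℂ)) ^ (i - k) * (i.choose k : ℂ) * v k

theorem phi_eq_phiFunctional {𝕜 : Type*} [RCLike 𝕜] [NormedAlgebra 𝕜 ℂ] (p : ℕ) {m : ℕ}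
    (hm : 1 ≤ m) (lam : ℂ) (s : ℕ) (t : 𝕜) :
    phi p m lam s t = phiFunctional m lam s fun k => degreeOp^[k] (rootFun p lam) t := by
  obtain ⟨r, rfl⟩ : ∃ r, m = r + 1 := ⟨m - 1, by omega⟩
  have hsplit : ∀ F : ℕ → ℂ, ∑ i ∈ Finset.range (r + 1), F i =
      F 0 + ∑ i ∈ Finset.Icc 1 (r + 1 - 1), F i := by
    intro F
    rw [Finset.range_eq_Ico, Finset.sum_eq_sum_Ico_succ_bot (Nat.succ_pos r)]
    rfl
  rw [phiFunctional, hsplit]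
  rcases s with _ | s
  · simp only [phi, pow_zero, div_one, one_mul, zero_add, Finset.range_one, Finset.sum_singleton,
      binetCoeff_zero, Nat.choose_self, Nat.cast_one, Nat.sub_self, Function.iterate_zero, id]
    congr 1
    refine Finset.sum_congr rfl fun i _ => ?_
    -- For s = 0 the factor (-s)^(i-k) leaves only k = i.
    rw [Finset.sum_eq_single_of_mem i (by simp)]
    · simp
    · intro k hk hki
      have : i - k ≠ 0 := by have := Finset.mem_range.mp hk; omega
      simp [this]
  · rw [mul_add]
    simp only [phi, zero_add, Finset.range_one, Finset.sum_singleton, pow_zero, mul_one,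
      binetCoeff_zero, Nat.choose_self, Nat.cast_one, Nat.sub_self, Function.iterate_zero, id,
      one_mul]
    congr 1
    rw [Finset.mul_sum]
    refine Finset.sum_congr rfl fun i _ => ?_
    rw [Finset.mul_sum]
    exact Finset.sum_congr rfl fun k _ => by ring

theorem phiFunctional_congr {m : ℕ} {lam : ℂ} {s : ℕ} {v w : ℕ → ℂ} (h : ∀ k < m, v k = w k) :
    phiFunctional m lam s v = phiFunctional m lam s w := by
  rw [phiFunctional, phiFunctional]
  congr 1
  refine Finset.sum_congr rfl fun i hi => Finset.sum_congr rfl fun k hk => ?_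
  rw [h k (by have := Finset.mem_range.mp hi; have := Finset.mem_range.mp hk; omega)]

theorem phiFunctional_add (m : ℕ) (lam : ℂ) (s : ℕ) (v w : ℕ → ℂ) :
    phiFunctional m lam s (fun k => v k + w k) =
      phiFunctional m lam s v + phiFunctional m lam s w := by
  simp only [phiFunctional, mul_add, Finset.sum_add_distrib]

/-- Binomial theorem: the inner sum over k is (x - s)^i. This is P(D - s) on an eigenvector of D
with eigenvalue x. -/
theorem phiFunctional_geometric (m : ℕ) (lam : ℂ) (s : ℕ) (c x : ℂ) :
    phiFunctional m lam s (fun k => c * x ^ k) =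
      c / lam ^ s * (binetPoly m).eval (x - s) := by
  rw [phiFunctional, eval_binetPoly, div_eq_mul_one_div c, mul_comm c, mul_assoc]
  congr 1
  rw [Finset.mul_sum]
  refine Finset.sum_congr rfl fun i _ => ?_
  rw [sub_eq_add_neg, add_pow, Finset.mul_sum, Finset.mul_sum]
  exact Finset.sum_congr rfl fun k _ => by ring

/-- The operator `D = z d/dz` on polynomials. -/
def eulerOp : ℂ[X] →ₗ[ℂ] ℂ[X] := LinearMap.mulLeft ℂ X ∘ₗ derivative

theorem eulerOp_apply (Q : ℂ[X]) : eulerOp Q = X * derivative Q := rfl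

theorem iterate_eulerOp_C_mul_X_pow (c : ℂ) (n k : ℕ) :
    eulerOp^[k] (C c * X ^ n) = C (c * (n : ℂ) ^ k) * X ^ n := by
  induction k with
  | zero => simp
  | succ k ih =>
    rw [Function.iterate_succ_apply', ih, eulerOp_apply, derivative_C_mul_X_pow]
    rcases n with _ | n
    · simp
    · rw [Nat.add_sub_cancel, pow_succ (((n + 1 : ℕ) : ℂ)), ← mul_assoc c]
      ring

theorem aeval_smul_eq_sum_phiFunctional {d : ℕ} {A : Matrix (Fin d) (Fin d) ℂ} {m : ℕ} {lam : ℂ}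
    (hm : 1 ≤ m) (hA : minpoly ℂ A = (X - C lam) ^ m) (hlam : ∀ s < m, lam ^ s ≠ 0)
    (τ : ℂ) (r : ℂ[X]) :
    aeval (τ • A) r = ∑ s ∈ Finset.range m,
      phiFunctional m lam s (fun k => (eulerOp^[k] (r.comp (C lam * X))).eval τ) •
        hornerMatrix A s := by
  induction r using Polynomial.induction_on' with
  | add r₁ r₂ h₁ h₂ =>
    rw [map_add, h₁, h₂, ← Finset.sum_add_distrib]
    refine Finset.sum_congr rfl fun s _ => ?_
    rw [← add_smul, ← phiFunctional_add]
    simp only [add_comp, iterate_map_add, eval_add]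
  | monomial n c =>
    have hv : ∀ k, (eulerOp^[k] ((monomial n c).comp (C lam * X))).eval τ =
        c * lam ^ n * τ ^ n * (n : ℂ) ^ k := by
      intro k
      rw [monomial_comp, mul_pow, ← C_pow, ← mul_assoc, ← C_mul, iterate_eulerOp_C_mul_X_pow]
      simp only [eval_mul, eval_C, eval_pow, eval_X]
      ring
    simp only [hv]
    rw [aeval_monomial, Algebra.algebraMap_eq_smul_one, smul_one_mul, _root_.smul_pow, smul_smul,
      pow_eq_sum_smul_hornerMatrix hA hlam (natDegree_binetPoly_lt hm) (eval_zero_binetPoly hm)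
        (fun s h1 h2 => eval_neg_binetPoly h1 h2) n, Finset.smul_sum]
    refine Finset.sum_congr rfl fun s _ => ?_
    rw [phiFunctional_geometric, smul_smul]
    congr 1
    ring

/-! ### Iterates of `D` on jets -/

section Jets

variable {𝕜 : Type*} [RCLike 𝕜] [NormedAlgebra 𝕜 ℂ]

theorem deriv_comp_algebraMap {F : ℂ → ℂ} {t : 𝕜} (hF : DifferentiableAt ℂ F (algebraMap 𝕜 ℂ t)) :
    deriv (fun s : 𝕜 => F (algebraMap 𝕜 ℂ s)) t = deriv F (algebraMap 𝕜 ℂ t) := by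
  have h1 : HasDerivAt (algebraMap 𝕜 ℂ) 1 t := by
    have := (algebraMapCLM 𝕜 ℂ).hasDerivAt (x := t)
    rwa [show algebraMapCLM 𝕜 ℂ 1 = 1 from map_one (algebraMap 𝕜 ℂ)] at this
  have h2 := HasDerivAt.scomp t hF.hasDerivAt h1
  rw [one_smul] at h2
  exact h2.deriv

/-- Each D costs one order of contact. The remainder lives on ℂ even when t is real, and the
identity holds near t, so that D can be applied again. -/
theorem degreeOp_jet {g : 𝕜 → ℂ} {t : 𝕜} {Q : ℂ[X]} {n : ℕ} {h : ℂ → ℂ}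
    (hh : AnalyticAt ℂ h (algebraMap 𝕜 ℂ t))
    (hg : ∀ᶠ s in 𝓝 t, g s = Q.eval (algebraMap 𝕜 ℂ s) +
      (algebraMap 𝕜 ℂ s - algebraMap 𝕜 ℂ t) ^ (n + 1) * h (algebraMap 𝕜 ℂ s)) :
    ∃ h' : ℂ → ℂ, AnalyticAt ℂ h' (algebraMap 𝕜 ℂ t) ∧
      ∀ᶠ s in 𝓝 t, degreeOp g s = (eulerOp Q).eval (algebraMap 𝕜 ℂ s) +
        (algebraMap 𝕜 ℂ s - algebraMap 𝕜 ℂ t) ^ n * h' (algebraMap 𝕜 ℂ s) := by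
  set τ := algebraMap 𝕜 ℂ t with hτ
  have hcont : Tendsto (algebraMap 𝕜 ℂ) (𝓝 t) (𝓝 τ) := (continuous_algebraMap 𝕜 ℂ).tendsto t
  -- This is z d/dz of (z - τ)^(n+1) h(z), divided by (z - τ)^n.
  refine ⟨fun z => z * ((n + 1) * h z + (z - τ) * deriv h z), ?_, ?_⟩
  · exact analyticAt_id.mul ((analyticAt_const.mul hh).add
      ((analyticAt_id.sub analyticAt_const).mul hh.deriv))
  · filter_upwards [eventually_eventually_nhds.mpr hg,
      hcont.eventually hh.eventually_analyticAt] with s hs han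
    set z := algebraMap 𝕜 ℂ s with hz
    have hd : HasDerivAt (fun w => Q.eval w + (w - τ) ^ (n + 1) * h w)
        (Q.derivative.eval z + ((((n + 1 : ℕ) : ℂ) * (z - τ) ^ n * 1) * h z +
          (z - τ) ^ (n + 1) * deriv h z)) z :=
      (Q.hasDerivAt z).add ((((hasDerivAt_id z).sub_const τ).pow (n + 1)).mul
        han.differentiableAt.hasDerivAt)
    rw [degreeOp, EventuallyEq.deriv_eq hs,
      deriv_comp_algebraMap (F := fun w => Q.eval w + (w - τ) ^ (n + 1) * h w)
        hd.differentiableAt, hd.deriv, Algebra.smul_def, eulerOp_apply, eval_mul, eval_X]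
    push_cast
    ring

theorem iterate_degreeOp_jet {g : 𝕜 → ℂ} {t : 𝕜} {Q : ℂ[X]} {m : ℕ} {h : ℂ → ℂ}
    (hh : AnalyticAt ℂ h (algebraMap 𝕜 ℂ t))
    (hg : ∀ᶠ s in 𝓝 t, g s = Q.eval (algebraMap 𝕜 ℂ s) +
      (algebraMap 𝕜 ℂ s - algebraMap 𝕜 ℂ t) ^ m * h (algebraMap 𝕜 ℂ s)) {k : ℕ} (hk : k < m) :
    degreeOp^[k] g t = (eulerOp^[k] Q).eval (algebraMap 𝕜 ℂ t) := by
  induction k generalizing g Q m h with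
  | zero =>
    have := hg.self_of_nhds
    rwa [sub_self, zero_pow (by omega), zero_mul, add_zero] at this
  | succ k ih =>
    obtain ⟨n, rfl⟩ : ∃ n, m = n + 1 := ⟨m - 1, by omega⟩
    obtain ⟨h', hh', hg'⟩ := degreeOp_jet hh hg
    rw [Function.iterate_succ_apply, Function.iterate_succ_apply]
    exact ih hh' hg' (by omega)

end Jets

/-! ### The branches of the root and their Hermite interpolants -/

theorem iteratedDeriv_eval (q : ℂ[X]) (k : ℕ) :
    iteratedDeriv k (fun w => q.eval w) = fun w => (derivative^[k] q).eval w := by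
  induction k with
  | zero => simp
  | succ k ih =>
    rw [iteratedDeriv_succ, ih, Function.iterate_succ_apply']
    ext w
    exact Polynomial.deriv _

/-- The derivatives of f - q below order m vanish at μ, so its analytic order there is at least m.
-/
theorem IsHermiteInterpolant.exists_eventually_eq {f : ℂ → ℂ} {μ : ℂ} {m : ℕ} {q : ℂ[X]}
    (hf : AnalyticAt ℂ f μ) (hq : IsHermiteInterpolant f ((X - C μ) ^ m) q) :
    ∃ g : ℂ → ℂ, AnalyticAt ℂ g μ ∧ ∀ᶠ w in 𝓝 μ, f w = q.eval w + (w - μ) ^ m * g w := by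
  have hqa : AnalyticAt ℂ (fun w => q.eval w) μ := q.differentiable.analyticAt μ
  obtain ⟨g, hg, hfg⟩ := (natCast_le_analyticOrderAt (hf.fun_sub hqa)).mp
    ((natCast_le_analyticOrderAt_iff_iteratedDeriv_eq_zero (hf.fun_sub hqa)).mpr fun k hk => by
      rw [iteratedDeriv_fun_sub hf.contDiffAt hqa.contDiffAt, iteratedDeriv_eval]
      dsimp only
      rw [hq μ k (by rwa [rootMultiplicity_X_sub_C_pow]), sub_self])
  refine ⟨g, hg, hfg.mono fun w hw => ?_⟩
  rw [← smul_eq_mul, ← hw, add_sub_cancel]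

theorem rootBranch_eq (p j : ℕ) {z : ℂ} (hz : z ≠ 0) :
    rootBranch p j z =
      Complex.exp (2 * Complex.I * (Real.pi : ℂ) * (j : ℂ) / (p : ℂ)) * z ^ (1 / (p : ℂ)) := by
  have hnorm : ((‖z‖ ^ (1 / (p : ℝ)) : ℝ) : ℂ) =
      Complex.exp ((Real.log ‖z‖ : ℂ) * (1 / (p : ℂ))) := by
    rw [Real.rpow_def_of_pos (norm_pos_iff.mpr hz)]
    push_cast
    rfl
  rw [rootBranch, hnorm, Complex.cpow_def_of_ne_zero hz, ← Complex.exp_add, ← Complex.exp_add,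
    Complex.log]
  congr 1
  ring

theorem analyticAt_cpow_const {z : ℂ} (hz : z ∈ Complex.slitPlane) (a : ℂ) :
    AnalyticAt ℂ (fun w => w ^ a) z :=
  analyticAt_id.cpow analyticAt_const hz

theorem rootBranch_eventuallyEq (p j : ℕ) {z : ℂ} (hz : z ∈ Complex.slitPlane) :
    rootBranch p j =ᶠ[𝓝 z] fun w =>
      Complex.exp (2 * Complex.I * (Real.pi : ℂ) * (j : ℂ) / (p : ℂ)) * w ^ (1 / (p : ℂ)) := by
  filter_upwards [Complex.isOpen_slitPlane.mem_nhds hz] with w hw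
  exact rootBranch_eq p j (Complex.slitPlane_ne_zero hw)

theorem analyticAt_rootBranch (p j : ℕ) {z : ℂ} (hz : z ∈ Complex.slitPlane) :
    AnalyticAt ℂ (rootBranch p j) z :=
  (analyticAt_const.mul (analyticAt_cpow_const hz _)).congr (rootBranch_eventuallyEq p j hz).symm

/-- Divisibility suffices: interpolating to order m at 1 - τλ meets every condition imposed by the
minimal polynomial. -/
theorem minpoly_one_sub_smul_dvd {d : ℕ} {A : Matrix (Fin d) (Fin d) ℂ} {m : ℕ} {lam : ℂ}
    (hA : minpoly ℂ A = (X - C lam) ^ m) (τ : ℂ) :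
    minpoly ℂ (1 - τ • A) ∣ (X - C (1 - τ * lam)) ^ m := by
  refine minpoly.dvd ℂ _ ?_
  have h := minpoly.aeval ℂ A
  rw [hA, map_pow, map_sub, aeval_X, aeval_C, Algebra.algebraMap_eq_smul_one] at h
  have h2 : (1 : Matrix (Fin d) (Fin d) ℂ) - τ • A - (1 - τ * lam) • (1 : Matrix _ _ ℂ) =
      (-τ) • (A - lam • (1 : Matrix _ _ ℂ)) := by
    module
  rw [map_pow, map_sub, aeval_X, aeval_C, Algebra.algebraMap_eq_smul_one, h2, _root_.smul_pow, h,
    smul_zero]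

theorem lt_of_lt_rootMultiplicity {M : ℂ[X]} {μ ν : ℂ} {m k : ℕ} (hM : M ∣ (X - C μ) ^ m)
    (hk : k < M.rootMultiplicity ν) : ν = μ ∧ k < m := by
  have h := hk.trans_le
    (rootMultiplicity_le_rootMultiplicity_of_dvd (pow_ne_zero m (X_sub_C_ne_zero μ)) hM ν)
  obtain rfl : ν = μ := by
    by_contra hne
    rw [rootMultiplicity_eq_zero] at h
    · exact Nat.not_lt_zero _ h
    · rw [IsRoot, eval_pow, eval_sub, eval_X, eval_C]
      exact pow_ne_zero _ (sub_ne_zero.mpr hne)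
  exact ⟨rfl, by rwa [rootMultiplicity_X_sub_C_pow] at h⟩

end PrimaryRoot
end
-- The formula for the branches of the root
theorem proposition4p1 {𝕜 : Type*} [RCLike 𝕜] [NormedAlgebra 𝕜 ℂ] {d : ℕ} (p : ℕ) (hp : 1 ≤ p)
    (A : Matrix (Fin d) (Fin d) ℂ) (m : ℕ) (lam : ℂ) (hlam : 2 ≤ m → lam ≠ 0)
    (hA : minpoly ℂ A = (Polynomial.X - Polynomial.C lam) ^ m)
    (j : ℕ) (hj : j < p) (t : 𝕜) (ht : t ≠ 0) (htlam : ‖t • lam‖ < 1) :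
    PrimaryRoot.DefinedOnSpectrum (PrimaryRoot.rootBranch p j) (1 - t • A) ∧
      PrimaryRoot.primaryMatrixFunction (PrimaryRoot.rootBranch p j) (1 - t • A) =
        Complex.exp (2 * Complex.I * (Real.pi : ℂ) * (j : ℂ) / (p : ℂ)) •
          ∑ s ∈ Finset.range m,
            PrimaryRoot.phi p m lam s t • PrimaryRoot.hornerMatrix A s := by
  open Polynomial PrimaryRoot Filter Topology in
  set τ : ℂ := algebraMap 𝕜 ℂ t with hτ
  set c : ℂ := Complex.exp (2 * Complex.I * (Real.pi : ℂ) * (j : ℂ) / (p : ℂ)) with hc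
  have htA : t • A = τ • A := (algebraMap_smul ℂ t A).symm
  rw [htA]
  have hdvd := minpoly_one_sub_smul_dvd hA τ
  set μ : ℂ := 1 - τ * lam with hμ
  have hslit : μ ∈ Complex.slitPlane := by
    rw [Algebra.smul_def, ← norm_neg] at htlam
    rw [hμ, sub_eq_add_neg]
    exact Complex.mem_slitPlane_of_norm_lt_one htlam
  refine ⟨fun ν hν => ?_, ?_⟩
  · rw [(lt_of_lt_rootMultiplicity hdvd hν).1]
    exact analyticAt_rootBranch p j hslit
  obtain ⟨q, hq⟩ := exists_hermiteInterpolant (fun w => w ^ (1 / (p : ℂ))) ((X - C μ) ^ m)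
  have hqb : IsHermiteInterpolant (rootBranch p j) (minpoly ℂ (1 - τ • A)) (C c * q) := by
    intro ν k hk
    obtain ⟨rfl, hkm⟩ := lt_of_lt_rootMultiplicity hdvd hk
    rw [(rootBranch_eventuallyEq p j hslit).iteratedDeriv_eq, iteratedDeriv_const_mul_field,
      iterate_derivative_C_mul, eval_C_mul, hq _ k (by rwa [rootMultiplicity_X_sub_C_pow])]
  rw [primaryMatrixFunction_eq_aeval hqb, map_mul, aeval_C, Algebra.algebraMap_eq_smul_one,
    smul_one_mul]
  congr 1
  -- If m = 0, the minimal polynomial is 1, so 1 = 0 in the matrix ring and both sides vanish.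
  rcases Nat.eq_zero_or_pos m with rfl | hm
  · have h1 := minpoly.aeval ℂ A
    rw [hA, pow_zero, map_one] at h1
    rw [Finset.range_zero, Finset.sum_empty, ← mul_one (aeval _ q), h1, mul_zero]
  have hpow : ∀ s < m, lam ^ s ≠ 0 := by
    intro s hs
    rcases Nat.eq_zero_or_pos s with rfl | hs0
    · rw [pow_zero]
      exact one_ne_zero
    · exact pow_ne_zero s (hlam (by omega))
  obtain ⟨g, hg, hqg⟩ := hq.exists_eventually_eq (analyticAt_cpow_const hslit _)
  set r : ℂ[X] := q.comp (1 - X) with hr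
  have haff : AnalyticAt ℂ (fun z : ℂ => 1 - z * lam) τ := by fun_prop
  -- The factor (-λ)^m comes from (1 - zλ) - μ = -λ(z - τ).
  have hjet : ∀ᶠ s in 𝓝 t, rootFun p lam s = (r.comp (C lam * X)).eval (algebraMap 𝕜 ℂ s) +
      (algebraMap 𝕜 ℂ s - algebraMap 𝕜 ℂ t) ^ m *
        (fun z => (-lam) ^ m * g (1 - z * lam)) (algebraMap 𝕜 ℂ s) := by
    have hcont : Tendsto (fun s : 𝕜 => 1 - algebraMap 𝕜 ℂ s * lam) (𝓝 t) (𝓝 μ) :=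
      haff.continuousAt.tendsto.comp ((continuous_algebraMap 𝕜 ℂ).tendsto t)
    filter_upwards [hcont.eventually hqg] with s hs
    rw [rootFun, Algebra.smul_def, hs]
    congr 1
    · simp [hr, eval_comp, mul_comm lam]
    · rw [← mul_assoc, ← mul_pow]
      congr 2
      rw [hμ]
      ring
  have hanal : AnalyticAt ℂ (fun z => (-lam) ^ m * g (1 - z * lam)) τ :=
    analyticAt_const.mul (AnalyticAt.fun_comp (f := fun z : ℂ => 1 - z * lam) hg haff)
  have hqr : aeval (1 - τ • A) q = aeval (τ • A) r := by
    rw [hr, aeval_comp, map_sub, map_one, aeval_X]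
  rw [hqr, aeval_smul_eq_sum_phiFunctional hm hA hpow]
  refine Finset.sum_congr rfl fun s _ => ?_
  rw [phi_eq_phiFunctional p hm]
  congr 1
  exact phiFunctional_congr fun k hk => (iterate_degreeOp_jet hanal hjet hk).symm
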